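/- For integers $a \le b$ regard $[a,b]^2$ as the graph whose vertices are the integer points $(x,y)$ with $a \le x, y \le b$, two vertices being adjacent when their $L_1$-distance is $1$. Let $c \ge 1$ be a real number and let $S_n = [-\lceil cn\rceil, \lceil cn\rceil]^2$ for $n \ge 0$. Given a sequence of activated vertices $\underline v = (v_0, v_1, v_2, \dots) \in \prod_{n\ge 0} V(S_n)$ (a vertex is activated at every step; no step is skipped), define the burning sets by $B_0 = \{v_0\}$ and $B_{n+1} = N_{S_{n+1}}[B_n] \cup \{v_{n+1}\}$ for $n \ge 0$, where $N_G[B]$ denotes the closed neighbourhood of $B$ in the graph $G$. The sequence $\underline v$ is called valid if $v_{n+1} \in V(S_{n+1}) \setminus N_{S_{n+1}}[B_n]$ for all $n \ge 0$. Then for every real $\rho \in \left[\frac{1}{2c^2}, 1\right]$ there is a valid sequence $\underline v \in \prod_{n \ge 0} V(S_n)$ whose burning density exists and equals $\rho$, that is, $$\lim_{n\to\infty} \frac{|B_n|}{|V(S_n)|} = \rho.$$ -/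

import Mathlib

open Filter Topology

namespace Burning

section General

variable {V : Type*} {H : SimpleGraph V}

/-- A sequence `G 0, G 1, …` of graphs with vertices in `V` (realised inside an ambient graph `H`
on `V`) is growing if each `G n` is an induced subgraph of `G (n + 1)`. -/
def IsGrowing (G : ℕ → H.Subgraph) : Prop :=
  ∀ n, (G n).verts ⊆ (G (n + 1)).verts ∧ (G (n + 1)).induce (G n).verts = G n

/-- The closed neighbourhood `N_K[B]` of a set of vertices `B` in the graph `K`. -/
def closedNbhd (K : H.Subgraph) (B : Set V) : Set V :=
  B ∪ {x | ∃ y ∈ B, K.Adj y x}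

/-- `v` is a sequence of activator vertices for `G`, that is, an element of the product over `n` of
`V(G n) ∪ {•}`. The value `none` stands for `•`: no vertex is activated at that step. -/
def IsActivatorSeq (G : ℕ → H.Subgraph) (v : ℕ → Option V) : Prop :=
  ∀ n x, v n = some x → x ∈ (G n).verts

/-- The set `B n` of vertices burning at time `n`. -/
def burned (G : ℕ → H.Subgraph) (v : ℕ → Option V) : ℕ → Set V
  | 0 => {x | v 0 = some x}
  | n + 1 => closedNbhd (G (n + 1)) (burned G v n) ∪ {x | v (n + 1) = some x}

/-- The sequence `v` is valid if each newly activated vertex lies in the current graph and is not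
already burned by a vertex from the previous time step. -/
def IsValid (G : ℕ → H.Subgraph) (v : ℕ → Option V) : Prop :=
  ∀ n x, v (n + 1) = some x →
    x ∈ (G (n + 1)).verts \ closedNbhd (G (n + 1)) (burned G v n)

/-- No step is skipped: a vertex is activated at every time. -/
def NoSkip (v : ℕ → Option V) : Prop :=
  ∀ n, v n ≠ none

/-- The burning density of `v` in `G` exists and equals `δ`. -/
def HasBurningDensity (G : ℕ → H.Subgraph) (v : ℕ → Option V) (δ : ℝ) : Prop :=
  Tendsto (fun n => ((burned G v n).ncard : ℝ) / ((G n).verts.ncard : ℝ)) atTop (𝓝 δ)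

end General

/-- The integer lattice `ℤ²`: points at `L¹`-distance `1` are adjacent. -/
def lattice : SimpleGraph (ℤ × ℤ) where
  Adj p q := |p.1 - q.1| + |p.2 - q.2| = 1
  symm := ⟨fun p q h => by rw [abs_sub_comm q.1, abs_sub_comm q.2]; exact h⟩
  loopless := ⟨fun p h => by simp at h⟩

/-- The square grid `[-m, m]²`, as an induced subgraph of the lattice. -/
def squareGrid (m : ℤ) : lattice.Subgraph :=
  (⊤ : lattice.Subgraph).induce (Set.Icc (-m) m ×ˢ Set.Icc (-m) m)

/-- The growing grids `S n = [-⌈c n⌉, ⌈c n⌉]²`. -/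
noncomputable def linearGrids (c : ℝ) (n : ℕ) : lattice.Subgraph :=
  squareGrid ⌈c * (n : ℝ)⌉

/-- The grids `S n` do form a growing sequence of graphs. -/
theorem isGrowing_linearGrids (c : ℝ) (hc : 0 ≤ c) : IsGrowing (linearGrids c) := by
  intro n
  have hm : ⌈c * (n : ℝ)⌉ ≤ ⌈c * ((n + 1 : ℕ) : ℝ)⌉ :=
    Int.ceil_le_ceil (mul_le_mul_of_nonneg_left (by push_cast; linarith) hc)
  have hs : (linearGrids c n).verts ⊆ (linearGrids c (n + 1)).verts := by
    rintro ⟨x, y⟩ h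
    simp only [linearGrids, squareGrid, SimpleGraph.Subgraph.induce_verts, Set.mem_prod,
      Set.mem_Icc] at h ⊢
    omega
  refine ⟨hs, ?_⟩
  ext p q
  · rfl
  · constructor
    · rintro ⟨hp, hq, -, -, h⟩
      exact ⟨hp, hq, h⟩
    · rintro ⟨hp, hq, h⟩
      exact ⟨hp, hq, hs hp, hs hq, h⟩

end Burning

namespace Burning

/-! Since `c ≥ 1`, the grid grows by at least one in every direction at each step, so fires never
feel the boundary: the burning set at time `n` is the union of the `L¹`-balls of radius `n - i`
about `v i` (`burned_linearGrids`). Validity then says that `v n` is at distance more than `n - i`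
from every earlier `v i`.

Scaled by `n`, the octagon `{p ∈ [-c, c]² | ‖p‖₁ ≤ t}` has area running continuously from `2` at `t
= 1` to `4 c²` at `t = 2 c`; pick `t` with area `4 c² ρ`. Let `T n` be the discrete octagon of
radius `f n ~ t n`, where `f` grows by at least one per step, so that fires lit in the targets stay
in them.

Always activate the point of `T n` with the most room around it (`exists_greedy_seq`). If `T n` is
already burned, activate instead a fallback vertex at most `κ n = o(n)` beyond it;
`exists_target_fallback` makes these always available. Thus the fire stays in the octagon of radius
`f n + κ n`. Conversely, if a point of `T m` stayed unburned for long, the greedy vertices would be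
too widely separated to fit in the square (`target_covered`), so `T (n - o(n))` is burned at time
`n`. Both bounds have the same limiting area. -/

/-! ### Lattice distance, grids and octagons -/

/-- The `L¹`-distance on `ℤ²`. -/
def l1Dist (p q : ℤ × ℤ) : ℤ := |p.1 - q.1| + |p.2 - q.2|

theorem l1Dist_comm (p q : ℤ × ℤ) : l1Dist p q = l1Dist q p := by
  simp only [l1Dist, abs_sub_comm]

theorem l1Dist_triangle (p q r : ℤ × ℤ) : l1Dist p r ≤ l1Dist p q + l1Dist q r := by
  have h₁ := abs_sub_le p.1 q.1 r.1
  have h₂ := abs_sub_le p.2 q.2 r.2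
  simp only [l1Dist]
  linarith

theorem exists_l1Dist_step {p q : ℤ × ℤ} (h : 0 < l1Dist p q) :
    ∃ p', l1Dist p' p = 1 ∧ l1Dist p' q = l1Dist p q - 1 := by
  obtain ⟨a, b⟩ := p
  obtain ⟨x, y⟩ := q
  simp only [l1Dist] at h ⊢
  rcases lt_trichotomy a x with hx | hx | hx
  · exact ⟨(a + 1, b), by simp, by grind⟩
  · rcases lt_trichotomy b y with hy | hy | hy
    · exact ⟨(a, b + 1), by simp, by grind⟩
    · simp [hx, hy] at h
    · exact ⟨(a, b - 1), by simp, by grind⟩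
  · exact ⟨(a - 1, b), by simp, by grind⟩

/-- The half side length `⌈c n⌉` of the `n`-th grid. -/
noncomputable def halfSide (c : ℝ) (n : ℕ) : ℤ := ⌈c * (n : ℝ)⌉

theorem halfSide_zero (c : ℝ) : halfSide c 0 = 0 := by simp [halfSide]

theorem halfSide_add_le {c : ℝ} (hc : 1 ≤ c) {i n : ℕ} (h : i ≤ n) :
    halfSide c i + (n - i) ≤ halfSide c n := by
  have hi : ((n : ℤ) - i : ℤ) = ((n - i : ℕ) : ℤ) := by omega
  rw [hi, halfSide, halfSide, ← Int.ceil_add_natCast]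
  apply Int.ceil_le_ceil
  rw [Nat.cast_sub h]
  have : (i : ℝ) ≤ n := by exact_mod_cast h
  nlinarith

theorem le_halfSide {c : ℝ} (hc : 1 ≤ c) (n : ℕ) : (n : ℤ) ≤ halfSide c n := by
  have := halfSide_add_le hc (Nat.zero_le n)
  rw [halfSide_zero] at this
  simpa using this

theorem halfSide_lt {c : ℝ} (n : ℕ) : (halfSide c n : ℝ) < c * n + 1 := Int.ceil_lt_add_one _

theorem le_halfSide_real {c : ℝ} (n : ℕ) : c * n ≤ (halfSide c n : ℝ) := Int.le_ceil _

/-- The points of the square `[-m, m]²` of `L¹`-norm at most `r`. -/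
noncomputable def octagon (m r : ℤ) : Finset (ℤ × ℤ) :=
  {p ∈ Finset.Icc (-m) m ×ˢ Finset.Icc (-m) m | |p.1| + |p.2| ≤ r}

theorem mem_octagon {m r : ℤ} {p : ℤ × ℤ} :
    p ∈ octagon m r ↔ (|p.1| ≤ m ∧ |p.2| ≤ m) ∧ |p.1| + |p.2| ≤ r := by
  simp [octagon, abs_le]

theorem octagon_subset {m m' r r' : ℤ} (hm : m ≤ m') (hr : r ≤ r') :
    octagon m r ⊆ octagon m' r' := by
  intro p
  simp only [mem_octagon]
  rintro ⟨⟨h₁, h₂⟩, h₃⟩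
  exact ⟨⟨h₁.trans hm, h₂.trans hm⟩, h₃.trans hr⟩

theorem mem_linearGrids {c : ℝ} {n : ℕ} {p : ℤ × ℤ} :
    p ∈ (linearGrids c n).verts ↔ |p.1| ≤ halfSide c n ∧ |p.2| ≤ halfSide c n := by
  simp only [linearGrids, squareGrid, SimpleGraph.Subgraph.induce_verts, Set.mem_prod,
    Set.mem_Icc, halfSide, abs_le]

theorem linearGrids_verts_eq_octagon (c : ℝ) (n : ℕ) :
    (linearGrids c n).verts = octagon (halfSide c n) (2 * halfSide c n) := by
  ext p
  rw [mem_linearGrids, Finset.mem_coe, mem_octagon]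
  constructor
  · intro h
    exact ⟨h, by linarith [h.1, h.2]⟩
  · exact fun h => h.1

theorem mem_linearGrids_of_l1Dist_le {c : ℝ} (hc : 1 ≤ c) {i n : ℕ} (h : i ≤ n) {p q : ℤ × ℤ}
    (hq : q ∈ (linearGrids c i).verts) (hd : l1Dist p q ≤ n - i) :
    p ∈ (linearGrids c n).verts := by
  rw [mem_linearGrids] at hq ⊢
  have := halfSide_add_le hc h
  simp only [l1Dist] at hd
  grind

/-! ### Burning sets as unions of balls -/

theorem burned_linearGrids {c : ℝ} (hc : 1 ≤ c) {v : ℕ → ℤ × ℤ}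
    (hv : ∀ n, v n ∈ (linearGrids c n).verts) (n : ℕ) :
    burned (linearGrids c) (fun n => some (v n)) n =
      {p | ∃ i ≤ n, l1Dist p (v i) ≤ n - i} := by
  induction n with
  | zero =>
    ext p
    simp only [burned, Set.mem_ofPred_eq, Option.some.injEq, Nat.le_zero, exists_eq_left,
      Nat.cast_zero, sub_zero, l1Dist]
    constructor
    · rintro rfl
      simp
    · intro h
      ext <;> grind
  | succ n ih =>
    ext p
    simp only [burned, ih, closedNbhd, Set.mem_union, Set.mem_ofPred_eq, Option.some.injEq]
    constructor
    · rintro ((⟨i, hi, h⟩ | ⟨q, ⟨i, hi, h⟩, hq⟩) | rfl)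
      · exact ⟨i, by omega, by push_cast; linarith⟩
      · refine ⟨i, by omega, ?_⟩
        have h₁ : l1Dist q p = 1 := hq.2.2
        have := l1Dist_triangle p q (v i)
        rw [l1Dist_comm p q] at this
        push_cast
        linarith
      · exact ⟨n + 1, le_rfl, by simp [l1Dist]⟩
    · rintro ⟨i, hi, h⟩
      rcases hi.lt_or_eq with hlt | rfl
      · left
        rcases le_or_gt (l1Dist p (v i)) (n - i) with h' | h'
        · exact Or.inl ⟨i, by omega, h'⟩
        · obtain ⟨p', h₁, h₂⟩ := exists_l1Dist_step (p := p) (q := v i) (by omega)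
          refine Or.inr ⟨p', ⟨i, by omega, ?_⟩, ?_⟩
          · push_cast at h
            linarith
          · refine ⟨?_, ?_, h₁⟩
            · exact mem_linearGrids_of_l1Dist_le hc hi (hv i) (by linarith)
            · exact mem_linearGrids_of_l1Dist_le hc hi (hv i) h
      · right
        simp only [l1Dist] at h
        ext <;> grind

/-- Reduces validity to strict distance inequalities between activated vertices. -/
theorem closedNbhd_burned_linearGrids {c : ℝ} (hc : 1 ≤ c) {v : ℕ → ℤ × ℤ}
    (hv : ∀ n, v n ∈ (linearGrids c n).verts) {n : ℕ} {p : ℤ × ℤ}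
    (hp : p ∈ closedNbhd (linearGrids c (n + 1)) (burned (linearGrids c) (fun n => some (v n)) n)) :
    ∃ i < n + 1, l1Dist p (v i) ≤ (n + 1 : ℕ) - i := by
  rw [burned_linearGrids hc hv] at hp
  rcases hp with ⟨i, hi, h⟩ | ⟨q, ⟨i, hi, h⟩, hq⟩
  · exact ⟨i, by omega, by push_cast; linarith⟩
  · refine ⟨i, by omega, ?_⟩
    have h₁ : l1Dist q p = 1 := hq.2.2
    have := l1Dist_triangle p q (v i)
    rw [l1Dist_comm p q] at this
    push_cast
    linarith

/-! ### Greedy activation and covering -/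

/-- Dependent recursion: a sequence can be built term by term as long as each term can be chosen
given the previous ones. -/
theorem exists_seq_of_history {α : Type*} [Inhabited α] (P : ℕ → (ℕ → α) → α → Prop)
    (hcongr : ∀ n u u' a, (∀ i < n, u i = u' i) → P n u a → P n u' a)
    (hstep : ∀ n u, (∀ i < n, P i u (u i)) → ∃ a, P n u a) :
    ∃ v : ℕ → α, ∀ n, P n v (v n) := by
  classical
  let step : ℕ → (ℕ → α) → α := fun n u => if h : ∃ a, P n u a then h.choose else default
  let v : ℕ → α := fun n => Nat.strongRec
    (fun n ih => step n (fun i => if h : i < n then ih i h else default)) n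
  have hv : ∀ n, v n = step n (fun i => if i < n then v i else default) := by
    intro n
    have : v n = step n (fun i => if h : i < n then v i else default) := by
      simp only [v]
      rw [Nat.strongRec]
    simpa using this
  refine ⟨v, fun n => ?_⟩
  induction n using Nat.strong_induction_on with
  | _ n ih =>
    have hex : ∃ a, P n (fun i => if i < n then v i else default) a := by
      obtain ⟨a, ha⟩ := hstep n v ih
      exact ⟨a, hcongr n _ _ a (fun i hi => by simp [hi]) ha⟩
    rw [hv n]
    simp only [step, dif_pos hex]
    exact hcongr n _ _ _ (fun i hi => by simp [hi]) hex.choose_spec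

/-- Greedy activation: a new vertex lies in the target set `T n` as far as possible from the fires
burning so far, and is the prescribed vertex `w n` when `T n` is already burned. -/
theorem exists_greedy_seq (T : ℕ → Finset (ℤ × ℤ)) (w : ℕ → ℤ × ℤ)
    (hT : ∀ n : ℕ, ∀ i < n, ∀ p ∈ T i, (n : ℤ) - i < l1Dist (w n) p)
    (hw : ∀ n : ℕ, ∀ i < n, (n : ℤ) - i < l1Dist (w n) (w i)) :
    ∃ v : ℕ → ℤ × ℤ, ∀ n, (v n ∈ T n ∨ v n = w n) ∧
      (∀ i < n, (n : ℤ) - i < l1Dist (v n) (v i)) ∧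
      ∀ p ∈ T n, ∀ d : ℤ, 0 < d → (∀ i < n, (n : ℤ) - i + d ≤ l1Dist p (v i)) →
        ∀ i < n, (n : ℤ) - i + d ≤ l1Dist (v n) (v i) := by
  apply exists_seq_of_history (fun n v a => (a ∈ T n ∨ a = w n) ∧
      (∀ i < n, (n : ℤ) - i < l1Dist a (v i)) ∧
      ∀ p ∈ T n, ∀ d : ℤ, 0 < d → (∀ i < n, (n : ℤ) - i + d ≤ l1Dist p (v i)) →
        ∀ i < n, (n : ℤ) - i + d ≤ l1Dist a (v i))
  · rintro n u u' a h ⟨h₁, h₂, h₃⟩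
    refine ⟨h₁, fun i hi => h i hi ▸ h₂ i hi, fun p hp d hd hpd i hi => ?_⟩
    rw [← h i hi]
    exact h₃ p hp d hd (fun j hj => (h j hj).symm ▸ hpd j hj) i hi
  · intro n u hu
    by_cases hex : ∃ p ∈ T n, ∀ i < n, (n : ℤ) - i < l1Dist p (u i)
    · obtain ⟨p₀, hp₀, hfar⟩ := hex
      rcases Nat.eq_zero_or_pos n with rfl | hn
      · exact ⟨p₀, Or.inl hp₀, by simp, by simp⟩
      have hne : (Finset.range n).Nonempty := ⟨0, by simpa using hn⟩
      -- The least distance from `p` to the balls burning at time `n`; the greedy vertex maximises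
      -- it.
      let gap : ℤ × ℤ → ℤ := fun p =>
        (Finset.range n).inf' hne fun i => l1Dist p (u i) - ((n : ℤ) - i)
      have hgap : ∀ p d, d ≤ gap p ↔ ∀ i < n, (n : ℤ) - i + d ≤ l1Dist p (u i) := by
        intro p d
        simp only [gap, Finset.le_inf'_iff, Finset.mem_range]
        exact forall₂_congr fun i _ => by constructor <;> intro h <;> linarith
      obtain ⟨a, ha, hmax⟩ := Finset.exists_max_image (T n) gap ⟨p₀, hp₀⟩
      refine ⟨a, Or.inl ha, fun i hi => ?_, fun p hp d _ hpd => ?_⟩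
      · have h₁ : 1 ≤ gap p₀ := (hgap p₀ 1).2 fun i hi => by linarith [hfar i hi]
        linarith [(hgap a 1).1 (h₁.trans (hmax p₀ hp₀)) i hi]
      · exact (hgap a d).1 (((hgap p d).2 hpd).trans (hmax p hp))
    -- Each earlier vertex is in `T i` or equals `w i`, so `hT` and `hw` make `w n` admissible. The
    -- greedy clause is vacuous since `T n` is burned.
    · refine ⟨w n, Or.inr rfl, fun i hi => ?_, fun p hp d hd hpd => ?_⟩
      · rcases (hu i hi).1 with h | h
        · exact hT n i hi _ h
        · rw [h]
          exact hw n i hi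
      · exact absurd ⟨p, hp, fun i hi => by linarith [hpd i hi]⟩ hex

/-- Pigeonhole: among sufficiently many points of a square two are close. -/
theorem exists_l1Dist_lt (v : ℕ → ℤ × ℤ) (m s : ℤ) (hs : 0 < s) (J : Finset ℕ)
    (hv : ∀ j ∈ J, |(v j).1| ≤ m ∧ |(v j).2| ≤ m)
    (hJ : (m / s - (-m) / s + 1).toNat ^ 2 < J.card) :
    ∃ i ∈ J, ∃ j ∈ J, i < j ∧ l1Dist (v j) (v i) < 2 * s := by
  let cell : ℕ → ℤ × ℤ := fun j => ((v j).1 / s, (v j).2 / s)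
  have hmaps : ∀ j ∈ J, cell j ∈
      Finset.Icc ((-m) / s) (m / s) ×ˢ Finset.Icc ((-m) / s) (m / s) := by
    intro j hj
    obtain ⟨h₁, h₂⟩ := hv j hj
    rw [abs_le] at h₁ h₂
    simp only [cell, Finset.mem_product, Finset.mem_Icc]
    exact ⟨⟨Int.ediv_le_ediv hs h₁.1, Int.ediv_le_ediv hs h₁.2⟩,
      Int.ediv_le_ediv hs h₂.1, Int.ediv_le_ediv hs h₂.2⟩
  have hcard : (Finset.Icc ((-m) / s) (m / s) ×ˢ Finset.Icc ((-m) / s) (m / s)).card < J.card := by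
    rw [Finset.card_product, Int.card_Icc, ← sq]
    convert hJ using 3
    ring
  obtain ⟨i, hi, j, hj, hij, heq⟩ := Finset.exists_ne_map_eq_of_card_lt_of_maps_to hcard hmaps
  have hclose : ∀ x y : ℤ, x / s = y / s → |x - y| < s := by
    intro x y hxy
    have h₁ := Int.mul_ediv_add_emod x s
    have h₂ := Int.mul_ediv_add_emod y s
    have h₃ := Int.emod_nonneg x hs.ne'
    have h₄ := Int.emod_nonneg y hs.ne'
    have h₅ := Int.emod_lt_of_pos x hs
    have h₆ := Int.emod_lt_of_pos y hs
    rw [hxy] at h₁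
    rw [abs_lt]
    constructor <;> linarith
  have hdist : l1Dist (v i) (v j) < 2 * s := by
    have h₁ := hclose _ _ (congrArg Prod.fst heq)
    have h₂ := hclose _ _ (congrArg Prod.snd heq)
    simp only [l1Dist]
    linarith
  rcases lt_or_gt_of_ne hij with h | h
  · exact ⟨i, hi, j, hj, h, l1Dist_comm (v i) (v j) ▸ hdist⟩
  · exact ⟨j, hj, i, hi, h, hdist⟩

/-- A greedy sequence covers `T m` after `4 s` further steps, if `2 s` exceeds the number of cells
of side `s` that meet the ambient square. -/
theorem target_covered {T : ℕ → Finset (ℤ × ℤ)} {v : ℕ → ℤ × ℤ} (hT : Monotone T)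
    (hgreedy : ∀ n, ∀ p ∈ T n, ∀ d : ℤ, 0 < d →
      (∀ i < n, (n : ℤ) - i + d ≤ l1Dist p (v i)) →
        ∀ i < n, (n : ℤ) - i + d ≤ l1Dist (v n) (v i))
    {m s : ℕ} {M : ℤ} (hs : 0 < s)
    (hv : ∀ j < m + 4 * s, |(v j).1| ≤ M ∧ |(v j).2| ≤ M)
    (hcells : (M / s - (-M) / s + 1).toNat ^ 2 < 2 * s) {p : ℤ × ℤ} (hp : p ∈ T m) :
    ∃ i ≤ m + 4 * s, l1Dist p (v i) ≤ (m + 4 * s : ℕ) - i := by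
  by_contra! hfar
  obtain ⟨i, hi, j, hj, hij, hlt⟩ := exists_l1Dist_lt v M s (by exact_mod_cast hs)
    (Finset.Ico m (m + 2 * s))
    (fun j hj => hv j (by rw [Finset.mem_Ico] at hj; omega)) (by simpa using hcells)
  rw [Finset.mem_Ico] at hi hj
  -- With this gap `d`, the sum `j - i + d = m + 4 s - i` does not depend on `j`. It exceeds `2 s`
  -- because `i < m + 2 s`, against the pigeonhole pair.
  have := hgreedy j p (hT hj.1 hp) ((m + 4 * s : ℕ) - j) (by push_cast; omega)
    (fun i hi => by linarith [hfar i (by omega)]) i hij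
  push_cast at this
  omega

/-! ### Counting octagons and limiting areas -/

theorem sum_Icc_neg_abs (g : ℕ → ℤ) (M : ℕ) :
    ∑ x ∈ Finset.Icc (-(M : ℤ)) M, g x.natAbs = g 0 + 2 * ∑ j ∈ Finset.range M, g (j + 1) := by
  induction M with
  | zero => simp
  | succ M ih =>
    have h : Finset.Icc (-((M + 1 : ℕ) : ℤ)) ((M + 1 : ℕ) : ℤ) =
        insert (-((M + 1 : ℕ) : ℤ)) (insert ((M + 1 : ℕ) : ℤ) (Finset.Icc (-(M : ℤ)) M)) := by
      ext x
      simp only [Finset.mem_Icc, Finset.mem_insert]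
      omega
    rw [h, Finset.sum_insert, Finset.sum_insert, ih, Finset.sum_range_succ, Int.natAbs_neg,
      Int.natAbs_natCast]
    · ring
    · simp
    · simp only [Finset.mem_insert, Finset.mem_Icc]
      omega

theorem card_octagon_eq_sum (M r : ℕ) :
    ((octagon M r).card : ℤ) =
      ∑ x ∈ Finset.Icc (-(M : ℤ)) M, max (2 * min (M : ℤ) (r - x.natAbs) + 1) 0 := by
  rw [octagon, Finset.card_filter, Finset.sum_product]
  push_cast
  refine Finset.sum_congr rfl fun x _ => ?_
  have h : ({y ∈ Finset.Icc (-(M : ℤ)) M | |x| + |y| ≤ (r : ℤ)} : Finset ℤ) =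
      Finset.Icc (-(min (M : ℤ) (r - |x|))) (min (M : ℤ) (r - |x|)) := by
    ext y
    simp only [Finset.mem_filter, Finset.mem_Icc]
    grind
  have h' := congrArg (fun s : Finset ℤ => (s.card : ℤ)) h
  simp only [Finset.card_filter, Int.card_Icc] at h'
  push_cast at h'
  rw [h', Int.toNat_eq_max]
  congr 1
  ring

/-- A free upper limit `N` permits induction; the last term vanishes in the application `N = M`, `r
≤ 2 M`. -/
theorem sum_octagon_slices (M r N : ℕ) :
    ∑ j ∈ Finset.range N, max (2 * min (M : ℤ) (r - ((j + 1 : ℕ) : ℤ)) + 1) 0 =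
      (r : ℤ) ^ 2 - (max ((r : ℤ) - N) 0) ^ 2
        - (max ((r : ℤ) - M) 0) * (max ((r : ℤ) - M) 0 - 1)
        + (max ((r : ℤ) - M - N) 0) * (max ((r : ℤ) - M - N) 0 - 1) := by
  induction N with
  | zero => simp
  | succ N ih =>
    rw [Finset.sum_range_succ, ih]
    push_cast
    rcases le_or_gt ((N : ℤ) + 1) r with h₁ | h₁
    · rw [max_eq_left (a := (r : ℤ) - N) (by omega), max_eq_left (a := (r : ℤ) - (N + 1)) (by omega)]
      rcases le_or_gt ((N : ℤ) + 1) ((r : ℤ) - M) with h₂ | h₂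
      · have h₃ : max (2 * min (M : ℤ) (r - (N + 1)) + 1) 0 = 2 * M + 1 := by omega
        rw [h₃, max_eq_left (a := (r : ℤ) - M - N) (by omega),
          max_eq_left (a := (r : ℤ) - M - (N + 1)) (by omega)]
        ring
      · have h₃ : max (2 * min (M : ℤ) (r - (N + 1)) + 1) 0 = 2 * (r - (N + 1)) + 1 := by omega
        rw [h₃, max_eq_right (a := (r : ℤ) - M - N) (by omega),
          max_eq_right (a := (r : ℤ) - M - (N + 1)) (by omega)]
        ring
    · have h₃ : max (2 * min (M : ℤ) (r - (N + 1)) + 1) 0 = 0 := by omega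
      rw [h₃, max_eq_right (a := (r : ℤ) - N) (by omega),
        max_eq_right (a := (r : ℤ) - (N + 1)) (by omega),
        max_eq_right (a := (r : ℤ) - M - N) (by omega),
        max_eq_right (a := (r : ℤ) - M - (N + 1)) (by omega)]
      ring

theorem card_octagon_nat {M r : ℕ} (h : r ≤ 2 * M) :
    ((octagon M r).card : ℤ) = 2 * (r : ℤ) ^ 2 + 2 * r + 1 - 4 * (max ((r : ℤ) - M) 0) ^ 2 := by
  rw [card_octagon_eq_sum,
    sum_Icc_neg_abs (fun j => max (2 * min (M : ℤ) (r - (j : ℤ)) + 1) 0) M, sum_octagon_slices,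
    max_eq_right (a := (r : ℤ) - M - M) (by omega)]
  rcases le_total r M with h' | h'
  · rw [max_eq_right (a := (r : ℤ) - M) (by omega), min_eq_right (by push_cast; omega),
      max_eq_left (by push_cast; omega)]
    push_cast
    ring
  · rw [max_eq_left (a := (r : ℤ) - M) (by omega), min_eq_left (by push_cast; omega),
      max_eq_left (by omega)]
    ring

theorem card_octagon {M r : ℤ} (hr : 0 ≤ r) (h : r ≤ 2 * M) :
    ((octagon M r).card : ℤ) = 2 * r ^ 2 + 2 * r + 1 - 4 * (max (r - M) 0) ^ 2 := by
  lift r to ℕ using hr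
  lift M to ℕ using by omega
  exact card_octagon_nat (by exact_mod_cast h)

/-- Lets the counting formula, valid only for `r ≤ 2 M`, apply to radii that overshoot the square.
-/
theorem octagon_min (M r : ℤ) : octagon M (min r (2 * M)) = octagon M r := by
  ext p
  simp only [mem_octagon]
  grind

/-- The area of the octagon `{p ∈ [-c, c]² | ‖p‖₁ ≤ t}`. -/
def octagonArea (c t : ℝ) : ℝ := 2 * t ^ 2 - 4 * (max (t - c) 0) ^ 2

theorem tendsto_card_octagon {c t : ℝ} (ht : t ≤ 2 * c) {M r : ℕ → ℤ} (hr : ∀ n, 0 ≤ r n)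
    (hM₀ : ∀ n, 0 ≤ M n)
    (hM : Tendsto (fun n => (M n : ℝ) / n) atTop (𝓝 c))
    (hrt : Tendsto (fun n => (r n : ℝ) / n) atTop (𝓝 t)) :
    Tendsto (fun n => ((octagon (M n) (r n)).card : ℝ) / (n : ℝ) ^ 2) atTop
      (𝓝 (octagonArea c t)) := by
  have hinv : Tendsto (fun n : ℕ => (1 : ℝ) / n) atTop (𝓝 0) := tendsto_one_div_atTop_nhds_zero_nat
  have hmin : Tendsto (fun n => min ((r n : ℝ) / n) (2 * ((M n : ℝ) / n))) atTop (𝓝 t) := by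
    simpa [min_eq_left ht] using hrt.min (hM.const_mul 2)
  have hlim : Tendsto (fun n : ℕ =>
      2 * (min ((r n : ℝ) / n) (2 * ((M n : ℝ) / n))) ^ 2 +
        2 * (min ((r n : ℝ) / n) (2 * ((M n : ℝ) / n))) * (1 / n) + (1 / (n : ℝ)) ^ 2 -
        4 * (max (min ((r n : ℝ) / n) (2 * ((M n : ℝ) / n)) - (M n : ℝ) / n) 0) ^ 2) atTop
      (𝓝 (octagonArea c t)) := by
    have := (((hmin.pow 2).const_mul 2).add ((hmin.const_mul 2).mul hinv)).add (hinv.pow 2)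
    have := this.sub ((((hmin.sub hM).max (tendsto_const_nhds (x := (0 : ℝ)))).pow 2).const_mul 4)
    convert this using 2
    simp [octagonArea]
  refine hlim.congr' ?_
  filter_upwards [eventually_gt_atTop 0] with n hn
  have hn' : (0 : ℝ) < n := by exact_mod_cast hn
  have hcard : ((octagon (M n) (r n)).card : ℝ) =
      2 * (min (r n : ℝ) (2 * M n)) ^ 2 + 2 * (min (r n : ℝ) (2 * M n)) + 1 -
        4 * (max (min (r n : ℝ) (2 * M n) - M n) 0) ^ 2 := by
    rw [← octagon_min]
    have := card_octagon (M := M n) (r := min (r n) (2 * M n))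
      (le_min (hr n) (by linarith [hM₀ n])) (min_le_right _ _)
    exact_mod_cast this
  have h₁ : min ((r n : ℝ) / n) (2 * ((M n : ℝ) / n)) = min (r n : ℝ) (2 * M n) / n := by
    rw [← mul_div_assoc, min_div_div_right hn'.le]
  have h₂ : max (min (r n : ℝ) (2 * M n) / n - (M n : ℝ) / n) 0 =
      max (min (r n : ℝ) (2 * M n) - M n) 0 / n := by
    rw [← sub_div, ← max_div_div_right hn'.le, zero_div]
  rw [h₁, h₂, hcard]
  field_simp

theorem exists_octagonArea_eq {c : ℝ} (hc : 1 ≤ c) {a : ℝ} (ha : a ∈ Set.Icc 2 (4 * c ^ 2)) :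
    ∃ t ∈ Set.Icc 1 (2 * c), octagonArea c t = a := by
  have hcont : ContinuousOn (octagonArea c) (Set.Icc 1 (2 * c)) := by
    unfold octagonArea
    fun_prop
  have h₁ : octagonArea c 1 = 2 := by
    rw [octagonArea, max_eq_right (by linarith)]
    ring
  have h₂ : octagonArea c (2 * c) = 4 * c ^ 2 := by
    rw [octagonArea, max_eq_left (by linarith)]
    ring
  have := intermediate_value_Icc (by linarith : (1 : ℝ) ≤ 2 * c) hcont
  rw [h₁, h₂] at this
  exact this ha

theorem tendsto_halfSide_div (c : ℝ) :
    Tendsto (fun n : ℕ => (halfSide c n : ℝ) / n) atTop (𝓝 c) := by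
  have hinv : Tendsto (fun n : ℕ => c + (1 : ℝ) / n) atTop (𝓝 (c + 0)) :=
    tendsto_one_div_atTop_nhds_zero_nat.const_add c
  rw [add_zero] at hinv
  refine tendsto_of_tendsto_of_tendsto_of_le_of_le' tendsto_const_nhds hinv ?_ ?_
  · filter_upwards [eventually_gt_atTop 0] with n hn
    have hn' : (0 : ℝ) < n := by exact_mod_cast hn
    rw [le_div_iff₀ hn']
    exact le_halfSide_real n
  · filter_upwards [eventually_gt_atTop 0] with n hn
    have hn' : (0 : ℝ) < n := by exact_mod_cast hn
    rw [div_le_iff₀ hn', add_mul, div_mul_cancel₀ _ hn'.ne']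
    exact (halfSide_lt n).le

theorem tendsto_sqrt_div : Tendsto (fun n : ℕ => (n.sqrt : ℝ) / n) atTop (𝓝 0) := by
  have h : Tendsto (fun n : ℕ => 1 / Real.sqrt n) atTop (𝓝 0) := by
    simp only [one_div]
    exact (Real.tendsto_sqrt_atTop.comp tendsto_natCast_atTop_atTop).inv_tendsto_atTop
  refine squeeze_zero (fun n => by positivity) (fun n => ?_) h
  rw [← Real.sqrt_div_self']
  exact div_le_div_of_nonneg_right Real.nat_sqrt_le_real_sqrt (by positivity)

/-! ### Target radii and fallback vertices -/

theorem sub_le_l1Dist (p q : ℤ × ℤ) : |p.1| + |p.2| - (|q.1| + |q.2|) ≤ l1Dist p q := by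
  have h₁ := abs_sub_abs_le_abs_sub p.1 q.1
  have h₂ := abs_sub_abs_le_abs_sub p.2 q.2
  simp only [l1Dist]
  linarith

/-- Radius of the target octagon: it grows by at least one at each step, equals `n` for small `n`,
and is asymptotic to `t n`. -/
noncomputable def targetRadius (t : ℝ) (L n : ℕ) : ℤ := max n (⌊t * n⌋ - L)

theorem targetRadius_add_le {t : ℝ} (ht : 1 ≤ t) (L : ℕ) {i n : ℕ} (h : i ≤ n) :
    targetRadius t L i + (n - i) ≤ targetRadius t L n := by
  have h₁ : ⌊t * i⌋ + ((n : ℤ) - i) ≤ ⌊t * n⌋ := by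
    have hi : ((n : ℤ) - i : ℤ) = ((n - i : ℕ) : ℤ) := by omega
    rw [hi, ← Int.floor_add_natCast]
    apply Int.floor_le_floor
    rw [Nat.cast_sub h]
    have : (i : ℝ) ≤ n := by exact_mod_cast h
    nlinarith
  simp only [targetRadius]
  omega

theorem tendsto_targetRadius_div {t : ℝ} (ht : 1 ≤ t) (L : ℕ) :
    Tendsto (fun n : ℕ => (targetRadius t L n : ℝ) / n) atTop (𝓝 t) := by
  have hinv : Tendsto (fun n : ℕ => (1 : ℝ) / n) atTop (𝓝 0) := tendsto_one_div_atTop_nhds_zero_nat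
  have hlow : Tendsto (fun n : ℕ => t - (L + 1) * ((1 : ℝ) / n)) atTop (𝓝 t) := by
    simpa using (hinv.const_mul ((L : ℝ) + 1)).const_sub t
  refine tendsto_of_tendsto_of_tendsto_of_le_of_le' hlow tendsto_const_nhds ?_ ?_
  · filter_upwards [eventually_gt_atTop 0] with n hn
    have hn' : (0 : ℝ) < n := by exact_mod_cast hn
    have h₁ := Int.sub_one_lt_floor (t * n)
    have h₂ : ((⌊t * n⌋ - L : ℤ) : ℝ) ≤ targetRadius t L n := by
      exact_mod_cast le_max_right _ _
    push_cast at h₂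
    rw [le_div_iff₀ hn']
    have : (t - (L + 1) * (1 / (n : ℝ))) * n = t * n - (L + 1) := by field_simp
    linarith
  · filter_upwards [eventually_gt_atTop 0] with n hn
    have hn' : (0 : ℝ) < n := by exact_mod_cast hn
    rw [div_le_iff₀ hn', targetRadius]
    push_cast
    refine max_le (by nlinarith) ?_
    linarith [Int.floor_le (t * n), (Nat.cast_nonneg L : (0 : ℝ) ≤ L)]

/-- Starting position of the `k`-th run of fallback vertices. -/
noncomputable def anchor (t : ℝ) (L k : ℕ) : ℤ := max (k ^ 2) (⌊t / 2 * (k : ℝ) ^ 2⌋ - L)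

/-- The first few fallback vertices, visiting the four quadrants in turn. -/
def initialFallback (n : ℕ) : ℤ × ℤ :=
  (if n % 4 < 2 then n else -n,
    if n % 2 = 0 then 1 + ((n : ℤ) - 1) / 4 else -(1 + ((n : ℤ) - 1) / 4))

/-- A vertex slightly outside the target octagon. -/
noncomputable def fallback (t : ℝ) (L n : ℕ) : ℤ × ℤ :=
  if n < 16 then initialFallback n else
    (anchor t L n.sqrt - (n - (n.sqrt : ℤ) ^ 2),
      targetRadius t L n + 1 + n.sqrt - (anchor t L n.sqrt - (n - (n.sqrt : ℤ) ^ 2)))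

theorem initialFallback_norm {n : ℕ} :
    |(initialFallback n).1| + |(initialFallback n).2| = n + (1 + ((n : ℤ) - 1) / 4) := by
  have h₁ : |(initialFallback n).1| = n := by
    simp only [initialFallback]
    split_ifs <;> simp
  have h₂ : |(initialFallback n).2| = 1 + ((n : ℤ) - 1) / 4 := by
    simp only [initialFallback]
    split_ifs <;> (try rw [abs_neg]) <;> rw [abs_of_nonneg (by omega)]
  rw [h₁, h₂]

theorem initialFallback_far : ∀ n : ℕ, n < 16 → ∀ i < n,
    (n : ℤ) - i < l1Dist (initialFallback n) (initialFallback i) := by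
  simp only [l1Dist, initialFallback]
  decide

theorem four_le_sqrt {n : ℕ} (h : 16 ≤ n) : 4 ≤ n.sqrt := Nat.le_sqrt.2 (by omega)

theorem fallback_fst_nonneg {t : ℝ} {L n : ℕ} (h : 16 ≤ n) : 0 ≤ (fallback t L n).1 := by
  have h₁ := four_le_sqrt h
  have h₂ := Nat.sqrt_le_add n
  have h₃ : ((n.sqrt : ℤ) ^ 2) ≤ anchor t L n.sqrt := le_max_left _ _
  simp only [fallback, not_lt.2 h, if_false]
  zify at h₁ h₂
  nlinarith

theorem anchor_le_targetRadius {t : ℝ} (ht : 1 ≤ t) (L n : ℕ) :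
    anchor t L n.sqrt ≤ targetRadius t L n := by
  have h₁ := Nat.sqrt_le' n
  apply max_le_max (by exact_mod_cast h₁)
  gcongr
  · exact half_le_self (by linarith)
  · exact_mod_cast h₁

theorem fallback_snd_nonneg {t : ℝ} (ht : 1 ≤ t) {L n : ℕ} (h : 16 ≤ n) :
    0 ≤ (fallback t L n).2 := by
  have h₁ := Nat.sqrt_le' n
  have h₂ := anchor_le_targetRadius ht L n
  simp only [fallback, not_lt.2 h, if_false]
  zify at h₁
  linarith

theorem fallback_norm {t : ℝ} (ht : 1 ≤ t) {L n : ℕ} (h : 16 ≤ n) :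
    |(fallback t L n).1| + |(fallback t L n).2| = targetRadius t L n + 1 + n.sqrt := by
  rw [abs_of_nonneg (fallback_fst_nonneg h), abs_of_nonneg (fallback_snd_nonneg ht h)]
  simp only [fallback, not_lt.2 h, if_false]
  ring

theorem targetRadius_eq {c t : ℝ} (ht : t ≤ 2 * c) {L n : ℕ} (hL : 32 * c ≤ L) (h : n < 16) :
    targetRadius t L n = n := by
  apply max_eq_left
  have h₁ : ⌊t * n⌋ ≤ (L : ℤ) := by
    rw [← Int.floor_natCast (R := ℝ) L]
    apply Int.floor_le_floor
    have : (n : ℝ) ≤ 16 := by exact_mod_cast h.le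
    have : (0 : ℝ) ≤ n := by positivity
    rcases le_total 0 t with h | h <;> nlinarith [(Nat.cast_nonneg L : (0 : ℝ) ≤ L)]
  omega

theorem fallback_norm_of_lt {c t : ℝ} (ht : t ≤ 2 * c) {L n : ℕ} (hL : 32 * c ≤ L) (h : n < 16) :
    |(fallback t L n).1| + |(fallback t L n).2| =
      targetRadius t L n + (1 + ((n : ℤ) - 1) / 4) := by
  rw [targetRadius_eq ht hL h, fallback, if_pos h, initialFallback_norm]

/-- When `n.sqrt` differs, the norms already differ by more than `n - i`, as the offset beyond the
target has grown. Within a run of constant `n.sqrt`, the first coordinate drops by `n - i` and the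
second rises by at least `2 (n - i)`. Before `16` the offset is at most `4`, afterwards at least
`5`. -/
theorem fallback_far {c t : ℝ} (ht₁ : 1 ≤ t) (ht₂ : t ≤ 2 * c) {L : ℕ} (hL : 32 * c ≤ L)
    {i n : ℕ} (hi : i < n) : (n : ℤ) - i < l1Dist (fallback t L n) (fallback t L i) := by
  have hr := targetRadius_add_le ht₁ L hi.le
  have hd := sub_le_l1Dist (fallback t L n) (fallback t L i)
  rcases lt_or_ge n 16 with hn | hn
  · have := initialFallback_far n hn i hi
    simpa [fallback, hn, hi.trans hn] using this
  have hk := four_le_sqrt hn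
  rw [fallback_norm ht₁ hn] at hd
  rcases lt_or_ge i 16 with hi' | hi'
  · rw [fallback_norm_of_lt ht₂ hL hi'] at hd
    omega
  rw [fallback_norm ht₁ hi'] at hd
  rcases (Nat.sqrt_le_sqrt hi.le).lt_or_eq with hs | hs
  · omega
  · simp only [l1Dist, fallback, not_lt.2 hn, not_lt.2 hi', if_false, hs]
    grind

/-- For large `n` both coordinates are `t n / 2 + O(√n)`, and the slack `(c - t / 2) n` absorbs the
error; the shift `L` postpones this regime until the slack is large enough. -/
theorem fallback_mem {c t : ℝ} (hc : 1 ≤ c) (ht₁ : 1 ≤ t) (ht₂ : t < 2 * c) {L : ℕ}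
    (hL : 8 * c * ((2 * c + 5) / (c - t / 2)) ^ 2 ≤ L) (n : ℕ) :
    |(fallback t L n).1| ≤ halfSide c n ∧ |(fallback t L n).2| ≤ halfSide c n := by
  have hn := le_halfSide hc n
  rcases lt_or_ge n 16 with h | h
  · simp only [fallback, h, if_true, initialFallback]
    constructor <;> split_ifs <;> (try rw [abs_neg]) <;> rw [abs_of_nonneg (by omega)] <;> omega
  rw [abs_of_nonneg (fallback_fst_nonneg h), abs_of_nonneg (fallback_snd_nonneg ht₁ h)]
  have hk := four_le_sqrt h
  have h₁ := Nat.sqrt_le' n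
  have h₂ := Nat.sqrt_le_add n
  have h₁' : ((n.sqrt : ℝ)) ^ 2 ≤ n := by exact_mod_cast h₁
  have h₂' : (n : ℝ) ≤ n.sqrt * n.sqrt + n.sqrt + n.sqrt := by exact_mod_cast h₂
  have hk' : (4 : ℝ) ≤ n.sqrt := by exact_mod_cast hk
  simp only [fallback, not_lt.2 h, if_false]
  constructor
  · have : anchor t L n.sqrt ≤ halfSide c n := by
      apply max_le
      · refine le_trans ?_ hn
        exact_mod_cast h₁
      · have : ((⌊t / 2 * (n.sqrt : ℝ) ^ 2⌋ : ℤ) : ℝ) ≤ halfSide c n := by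
          refine (Int.floor_le _).trans (le_trans ?_ (le_halfSide_real n))
          apply mul_le_mul (by linarith) h₁' (by positivity) (by linarith)
        have : ⌊t / 2 * (n.sqrt : ℝ) ^ 2⌋ ≤ halfSide c n := by exact_mod_cast this
        omega
    zify at h₁
    linarith
  · rcases le_total ((⌊t * n⌋ : ℤ) - L) n with hle | hle
    -- With `k = n.sqrt`, the second coordinate is at most `n + 1 + 3 k - k ^ 2`, hence at most `n`
    -- once `k ≥ 4`: the origin of the threshold `16`.
    · rw [targetRadius, max_eq_left hle]
      have h₃ : ((n.sqrt : ℤ) ^ 2) ≤ anchor t L n.sqrt := le_max_left _ _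
      zify at hk h₂
      nlinarith
    · rw [targetRadius, max_eq_right hle]
      have h₃ : ⌊t / 2 * (n.sqrt : ℝ) ^ 2⌋ - (L : ℤ) ≤ anchor t L n.sqrt := le_max_right _ _
      have h₄ := Int.sub_one_lt_floor (t / 2 * (n.sqrt : ℝ) ^ 2)
      have h₅ := Int.floor_le (t * n)
      have h₆ : (n : ℝ) ≤ ⌊t * n⌋ - L := by exact_mod_cast hle
      have h₇ := le_halfSide_real (c := c) n
      have hδ : 0 < c - t / 2 := by linarith
      -- Here `L ≤ t n ≤ 2 c n ≤ 8 c k ^ 2` with `k = n.sqrt`, which turns the lower bound on `L`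
      -- into one on `k`.
      have hbig : 2 * c + 5 ≤ (c - t / 2) * n.sqrt := by
        have : ((2 * c + 5) / (c - t / 2)) ^ 2 ≤ (n.sqrt : ℝ) ^ 2 := by
          have h₈ : 8 * c * ((2 * c + 5) / (c - t / 2)) ^ 2 ≤ 8 * c * (n.sqrt : ℝ) ^ 2 := by
            have : (n : ℝ) ≤ 4 * (n.sqrt : ℝ) ^ 2 := by nlinarith
            nlinarith
          exact le_of_mul_le_mul_left h₈ (by linarith)
        have := (abs_le_of_sq_le_sq' this (by positivity)).2
        rw [div_le_iff₀ hδ] at this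
        linarith
      have hmain : (targetRadius t L n : ℝ) = ⌊t * n⌋ - L := by
        rw [targetRadius, max_eq_right hle]
        push_cast
        rfl
      have h₉ : ((⌊t / 2 * (n.sqrt : ℝ) ^ 2⌋ : ℤ) : ℝ) - L ≤ anchor t L n.sqrt := by
        exact_mod_cast h₃
      have : ((⌊t * n⌋ - L + 1 + n.sqrt - (anchor t L n.sqrt - (n - (n.sqrt : ℤ) ^ 2)) : ℤ) : ℝ) ≤
          halfSide c n := by
        push_cast
        have h₁₀ : (2 * c + 5) * n.sqrt ≤ (c - t / 2) * n := by nlinarith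
        nlinarith
      exact_mod_cast this

/-- Target radii `f` asymptotic to `t n`, together with fallback vertices just outside the target
octagons, spread out so that they can always be activated. -/
theorem exists_target_fallback {c t : ℝ} (hc : 1 ≤ c) (ht : t ∈ Set.Icc 1 (2 * c)) :
    ∃ (f κ : ℕ → ℤ) (w : ℕ → ℤ × ℤ),
      (∀ n, 0 ≤ f n) ∧ (∀ i n, i ≤ n → f i + (n - i) ≤ f n) ∧ (∀ n, 0 ≤ κ n) ∧ Monotone κ ∧
      (∀ n, w n ∈ octagon (halfSide c n) (f n + κ n)) ∧
      (∀ n : ℕ, ∀ i < n, ∀ p ∈ octagon (halfSide c i) (f i), (n : ℤ) - i < l1Dist (w n) p) ∧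
      (∀ n : ℕ, ∀ i < n, (n : ℤ) - i < l1Dist (w n) (w i)) ∧
      Tendsto (fun n => (f n : ℝ) / n) atTop (𝓝 t) ∧
      Tendsto (fun n => (κ n : ℝ) / n) atTop (𝓝 0) := by
  obtain ⟨ht₁, ht₂⟩ := ht
  rcases ht₂.lt_or_eq with hlt | rfl
  · obtain ⟨L, hL⟩ := exists_nat_ge (max (32 * c) (8 * c * ((2 * c + 5) / (c - t / 2)) ^ 2))
    obtain ⟨hL₁, hL₂⟩ := max_le_iff.1 hL
    refine ⟨targetRadius t L, fun n => 4 + n.sqrt, fallback t L,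
      fun n => (Int.natCast_nonneg n).trans (le_max_left _ _),
      fun i n h => targetRadius_add_le ht₁ L h, fun n => by positivity, ?_, ?_, ?_,
      fun n i hi => fallback_far ht₁ ht₂ hL₁ hi, tendsto_targetRadius_div ht₁ L, ?_⟩
    · intro a b h
      have := Nat.sqrt_le_sqrt h
      simp only
      omega
    · intro n
      refine mem_octagon.2 ⟨fallback_mem hc ht₁ hlt hL₂ n, ?_⟩
      rcases lt_or_ge n 16 with h | h
      · rw [fallback_norm_of_lt ht₂ hL₁ h]
        dsimp only
        omega
      · rw [fallback_norm ht₁ h]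
        dsimp only
        omega
    · intro n i hi p hp
      have h₁ := sub_le_l1Dist (fallback t L n) p
      have h₂ := targetRadius_add_le ht₁ L hi.le
      have h₃ := (mem_octagon.1 hp).2
      rcases lt_or_ge n 16 with h | h
      · rw [fallback_norm_of_lt ht₂ hL₁ h] at h₁
        omega
      · rw [fallback_norm ht₁ h] at h₁
        omega
    · have := (tendsto_one_div_atTop_nhds_zero_nat.const_mul (4 : ℝ)).add tendsto_sqrt_div
      simp only [mul_zero, add_zero] at this
      refine this.congr fun n => ?_
      push_cast
      ring
  -- For `t = 2 c` there is no slack, but the target is the whole square and its new corner is at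
  -- distance at least `2 (n - i)` from the `i`-th square.
  · have hfar : ∀ n : ℕ, ∀ i < n, ∀ p : ℤ × ℤ, |p.1| ≤ halfSide c i → |p.2| ≤ halfSide c i →
        (n : ℤ) - i < l1Dist (halfSide c n, halfSide c n) p := by
      intro n i hi p h₁ h₂
      have := halfSide_add_le hc hi.le
      simp only [l1Dist]
      grind
    have hnn : ∀ n, 0 ≤ halfSide c n := fun n => (Int.natCast_nonneg n).trans (le_halfSide hc n)
    refine ⟨fun n => 2 * halfSide c n, fun _ => 0, fun n => (halfSide c n, halfSide c n),
      fun n => by linarith [hnn n], fun i n h => by linarith [halfSide_add_le hc h],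
      fun _ => le_rfl, monotone_const, fun n => mem_octagon.2 ?_,
      fun n i hi p hp => ?_, fun n i hi => ?_, ?_, by simp⟩
    · simp only [abs_of_nonneg (hnn n)]
      exact ⟨⟨le_rfl, le_rfl⟩, by linarith⟩
    · exact hfar n i hi p (mem_octagon.1 hp).1.1 (mem_octagon.1 hp).1.2
    · exact hfar n i hi _ (abs_of_nonneg (hnn i)).le (abs_of_nonneg (hnn i)).le
    · refine ((tendsto_halfSide_div c).const_mul 2).congr fun n => ?_
      push_cast
      ring

/-! ### Covering time and squeeze -/

/-- A scale of order `n ^ (3 / 4)`. -/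
def scale (n : ℕ) : ℕ := n.sqrt * n.sqrt.sqrt

theorem tendsto_nat_sqrt : Tendsto Nat.sqrt atTop atTop :=
  tendsto_atTop_atTop_of_monotone (fun _ _ h => Nat.sqrt_le_sqrt h)
    fun b => ⟨b * b, (Nat.sqrt_eq b).ge⟩

theorem tendsto_scale_div : Tendsto (fun n : ℕ => (scale n : ℝ) / n) atTop (𝓝 0) := by
  have h := tendsto_one_div_atTop_nhds_zero_nat (𝕜 := ℝ).comp
    (tendsto_nat_sqrt.comp tendsto_nat_sqrt)
  refine squeeze_zero' (Eventually.of_forall fun n => by positivity) ?_ h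
  filter_upwards [eventually_gt_atTop 0] with n hn
  have hk : 0 < n.sqrt := Nat.sqrt_pos.2 hn
  have hq : 0 < n.sqrt.sqrt := Nat.sqrt_pos.2 hk
  have h₁ := Nat.sqrt_le' n
  have h₂ := Nat.sqrt_le' n.sqrt
  simp only [Function.comp_apply]
  rw [div_le_div_iff₀ (by exact_mod_cast hn) (by exact_mod_cast hq)]
  norm_cast
  simp only [scale]
  nlinarith

/-- Cells of side about `n ^ (3 / 4)` number `O(n ^ (1 / 2))`. Any exponent strictly between `2 / 3`
and `1` would make the scale both `o(n)` and larger than the cell count. -/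
theorem eventually_cells_lt_scale {c : ℝ} (hc : 1 ≤ c) :
    ∀ᶠ n : ℕ in atTop, 0 < scale n ∧
      (halfSide c n / scale n - (-halfSide c n) / scale n + 1).toNat ^ 2 < 2 * scale n := by
  -- `18 = 2 · 3 · 3`, from `halfSide c n ≤ 2 c n`, `n ≤ 3 k ^ 2` and `k ≤ 3 q ^ 2`.
  obtain ⟨C, hC⟩ := exists_nat_ge (18 * c)
  filter_upwards [eventually_gt_atTop 0,
    (tendsto_nat_sqrt.comp tendsto_nat_sqrt).eventually_gt_atTop (8 * C ^ 2)] with n hn hbig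
  simp only [Function.comp_apply] at hbig
  have hk : 0 < n.sqrt := Nat.sqrt_pos.2 hn
  have hq : 0 < n.sqrt.sqrt := Nat.sqrt_pos.2 hk
  have h₁ := Nat.sqrt_le_add n
  have h₂ := Nat.sqrt_le_add n.sqrt
  have h₃ := Nat.sqrt_le' n.sqrt
  have hH := halfSide_lt (c := c) n
  have hH₀ := le_halfSide hc n
  simp only [scale]
  generalize hkk : n.sqrt = k at *
  generalize hqq : k.sqrt = q at *
  have hs : 0 < k * q := Nat.mul_pos hk hq
  refine ⟨hs, ?_⟩
  have hC1 : 1 ≤ C := by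
    have : (1 : ℝ) ≤ C := by linarith
    exact_mod_cast this
  have hle : halfSide c n ≤ ((C * q : ℕ) : ℤ) * ((k * q : ℕ) : ℤ) := by
    have hk₁ : (1 : ℝ) ≤ k := by exact_mod_cast hk
    have hq₁ : (1 : ℝ) ≤ q := by exact_mod_cast hq
    have hn₁ : (1 : ℝ) ≤ n := by exact_mod_cast hn
    have h₁' : (n : ℝ) ≤ k * k + k + k := by exact_mod_cast h₁
    have h₂' : (k : ℝ) ≤ q * q + q + q := by exact_mod_cast h₂
    have e₁ : (n : ℝ) ≤ 3 * k ^ 2 := by nlinarith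
    have e₂ : (k : ℝ) ≤ 3 * q ^ 2 := by nlinarith
    have e₃ : (halfSide c n : ℝ) ≤ 2 * c * n := by nlinarith
    have e₄ : 2 * c * n ≤ 6 * c * k ^ 2 := by nlinarith
    have e₅ : (k : ℝ) ^ 2 ≤ k * (3 * q ^ 2) := by nlinarith
    have e₆ : 6 * c * (k : ℝ) ^ 2 ≤ 6 * c * (k * (3 * q ^ 2)) := by gcongr
    have e₇ : 18 * c * (k * (q : ℝ) ^ 2) ≤ C * (k * (q : ℝ) ^ 2) := by gcongr
    have : (halfSide c n : ℝ) ≤ C * q * (k * q) := by linarith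
    exact_mod_cast this
  have hs' : (0 : ℤ) < ((k * q : ℕ) : ℤ) := by exact_mod_cast hs
  have hup : halfSide c n / ((k * q : ℕ) : ℤ) ≤ ((C * q : ℕ) : ℤ) :=
    Int.ediv_le_of_le_mul hs' hle
  have hlow : -((C * q : ℕ) : ℤ) ≤ (-halfSide c n) / ((k * q : ℕ) : ℤ) :=
    Int.le_ediv_of_mul_le hs' (by linarith)
  have hcells : (halfSide c n / ((k * q : ℕ) : ℤ) - (-halfSide c n) / ((k * q : ℕ) : ℤ) + 1).toNat
      ≤ 3 * (C * q) := by
    have : 1 ≤ C * q := Nat.mul_pos hC1 hq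
    omega
  calc _ ≤ (3 * (C * q)) ^ 2 := Nat.pow_le_pow_left hcells 2
    _ = 9 * C ^ 2 * q ^ 2 := by ring
    _ ≤ 9 * C ^ 2 * k := Nat.mul_le_mul_left _ h₃
    _ < 2 * (k * q) := by nlinarith [Nat.mul_lt_mul_of_pos_left hbig hk]

theorem tendsto_sub_scale_div :
    Tendsto (fun n : ℕ => ((n - 4 * scale n : ℕ) : ℝ) / n) atTop (𝓝 1) := by
  have h : Tendsto (fun n : ℕ => 1 - 4 * ((scale n : ℝ) / n)) atTop (𝓝 1) := by
    simpa using (tendsto_scale_div.const_mul 4).const_sub 1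
  refine h.congr' ?_
  filter_upwards [eventually_gt_atTop 0, tendsto_scale_div.eventually_lt_const
    (by norm_num : (0 : ℝ) < 1 / 4)] with n hn hlt
  have hn' : (0 : ℝ) < n := by exact_mod_cast hn
  rw [div_lt_iff₀ hn'] at hlt
  have : 4 * scale n ≤ n := by
    have : (4 * scale n : ℝ) ≤ n := by linarith
    exact_mod_cast this
  rw [Nat.cast_sub this, sub_div, div_self hn'.ne', mul_div_assoc']
  push_cast
  rfl

theorem tendsto_sub_scale : Tendsto (fun n : ℕ => n - 4 * scale n) atTop atTop := by
  rw [← tendsto_natCast_atTop_iff (R := ℝ)]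
  refine ((tendsto_natCast_atTop_atTop (R := ℝ)).atTop_mul_pos one_pos
    tendsto_sub_scale_div).congr' ?_
  filter_upwards [eventually_gt_atTop 0] with n hn
  have hn' : (0 : ℝ) < n := by exact_mod_cast hn
  field_simp

theorem eventually_four_scale_le : ∀ᶠ n : ℕ in atTop, 4 * scale n ≤ n := by
  filter_upwards [tendsto_sub_scale.eventually_gt_atTop 0] with n hn
  omega

/-- If the burning sets lie between the octagons of radii `f (n - o(n))` and `f n + o(n)`, then
they have the area of the limiting octagon. -/
theorem tendsto_card_of_between {c t : ℝ} (hc : 1 ≤ c) (ht : t ≤ 2 * c) {f κ : ℕ → ℤ}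
    (hf : ∀ n, 0 ≤ f n) (hκ : ∀ n, 0 ≤ κ n)
    (hft : Tendsto (fun n => (f n : ℝ) / n) atTop (𝓝 t))
    (hκt : Tendsto (fun n => (κ n : ℝ) / n) atTop (𝓝 0)) {B : ℕ → Set (ℤ × ℤ)}
    (hlow : ∀ᶠ n in atTop,
      (octagon (halfSide c (n - 4 * scale n)) (f (n - 4 * scale n)) : Set (ℤ × ℤ)) ⊆ B n)
    (hup : ∀ n, B n ⊆ octagon (halfSide c n) (f n + κ n)) :
    Tendsto (fun n => ((B n).ncard : ℝ) / (n : ℝ) ^ 2) atTop (𝓝 (octagonArea c t)) := by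
  have hH : ∀ n, 0 ≤ halfSide c n := fun n => (Int.natCast_nonneg n).trans (le_halfSide hc n)
  have h₁ := tendsto_card_octagon ht hf hH (tendsto_halfSide_div c) hft
  have h₂ := tendsto_card_octagon ht (fun n => add_nonneg (hf n) (hκ n)) hH
    (tendsto_halfSide_div c) (r := fun n => f n + κ n) (by
      have := hft.add hκt
      rw [add_zero] at this
      refine this.congr fun n => ?_
      push_cast
      ring)
  have h₃ := (h₁.comp tendsto_sub_scale).mul (tendsto_sub_scale_div.pow 2)
  rw [one_pow, mul_one] at h₃
  refine tendsto_of_tendsto_of_tendsto_of_le_of_le' h₃ h₂ ?_ ?_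
  · filter_upwards [hlow, tendsto_sub_scale.eventually_gt_atTop 0] with n hn hpos
    have hpos' : (0 : ℝ) < (n - 4 * scale n : ℕ) := by exact_mod_cast hpos
    simp only [Function.comp_apply]
    rw [div_pow, div_mul_div_cancel₀ (by positivity)]
    have := Set.ncard_le_ncard hn ((octagon _ _).finite_toSet.subset (hup n))
    rw [Set.ncard_coe_finset] at this
    gcongr
  · refine Eventually.of_forall fun n => ?_
    have := Set.ncard_le_ncard (hup n) (octagon _ _).finite_toSet
    rw [Set.ncard_coe_finset] at this
    gcongr

theorem tendsto_card_linearGrids {c : ℝ} (hc : 1 ≤ c) :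
    Tendsto (fun n : ℕ => ((linearGrids c n).verts.ncard : ℝ) / (n : ℝ) ^ 2) atTop
      (𝓝 (4 * c ^ 2)) := by
  have hH : ∀ n, 0 ≤ halfSide c n := fun n => (Int.natCast_nonneg n).trans (le_halfSide hc n)
  have h := tendsto_card_octagon (t := 2 * c) le_rfl (r := fun n => 2 * halfSide c n)
    (fun n => by linarith [hH n]) hH (tendsto_halfSide_div c) (by
      refine ((tendsto_halfSide_div c).const_mul 2).congr fun n => ?_
      push_cast
      ring)
  have harea : octagonArea c (2 * c) = 4 * c ^ 2 := by
    rw [octagonArea, max_eq_left (by linarith)]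
    ring
  rw [harea] at h
  refine h.congr fun n => ?_
  rw [linearGrids_verts_eq_octagon, Set.ncard_coe_finset]


end Burning

/-! ### Assembly of the theorem -/

open Burning in
theorem mainTheorem1 (c : ℝ) (hc : 1 ≤ c) (ρ : ℝ) (hρ : ρ ∈ Set.Icc (1 / (2 * c ^ 2)) 1) :
    ∃ v : ℕ → Option (ℤ × ℤ),
      Burning.IsActivatorSeq (Burning.linearGrids c) v ∧
      Burning.NoSkip v ∧
      Burning.IsValid (Burning.linearGrids c) v ∧
      Burning.HasBurningDensity (Burning.linearGrids c) v ρ := by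
  have hc₂ : 0 < c ^ 2 := by positivity
  obtain ⟨t, ht, harea⟩ := exists_octagonArea_eq hc (a := 4 * c ^ 2 * ρ) (by
    have h₁ := hρ.1
    rw [div_le_iff₀ (by positivity)] at h₁
    exact ⟨by linarith, by nlinarith [hρ.2]⟩)
  obtain ⟨f, κ, w, hf₀, hf, hκ₀, hκ, hw, hwT, hww, hft, hκt⟩ := exists_target_fallback hc ht
  obtain ⟨v, hv⟩ := exists_greedy_seq (fun n => octagon (halfSide c n) (f n)) w hwT hww
  have hvo : ∀ n, v n ∈ octagon (halfSide c n) (f n + κ n) := by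
    intro n
    rcases (hv n).1 with h | h
    · exact octagon_subset le_rfl (by linarith [hκ₀ n]) h
    · exact h ▸ hw n
  have hvg : ∀ n, v n ∈ (linearGrids c n).verts := fun n =>
    mem_linearGrids.2 (mem_octagon.1 (hvo n)).1
  have hHmono : Monotone (halfSide c) := fun i n h => by
    have := halfSide_add_le hc h
    omega
  have hTmono : Monotone fun n => octagon (halfSide c n) (f n) := fun i n h =>
    octagon_subset (hHmono h) (by have := hf i n h; omega)
  have hcard : Tendsto
      (fun n => ((burned (linearGrids c) (fun n => some (v n)) n).ncard : ℝ) / (n : ℝ) ^ 2) atTop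
      (𝓝 (octagonArea c t)) := by
    refine tendsto_card_of_between hc ht.2 hf₀ hκ₀ hft hκt ?_ ?_
    · filter_upwards [eventually_cells_lt_scale hc, eventually_four_scale_le] with n hn hle
      intro p hp
      have hsum : n - 4 * scale n + 4 * scale n = n := Nat.sub_add_cancel hle
      have := target_covered hTmono (fun n => (hv n).2.2) (m := n - 4 * scale n) hn.1
        (M := halfSide c n) (fun j hj => by
          have h := (mem_octagon.1 (hvo j)).1
          have hjn : halfSide c j ≤ halfSide c n := hHmono (by omega)
          exact ⟨h.1.trans hjn, h.2.trans hjn⟩) hn.2 hp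
      rw [hsum] at this
      rw [burned_linearGrids hc hvg]
      exact this
    · intro n p hp
      have hp' := hp
      rw [burned_linearGrids hc hvg] at hp'
      obtain ⟨i, hi, hd⟩ := hp'
      have h₁ := mem_linearGrids.1 (mem_linearGrids_of_l1Dist_le hc hi (hvg i) hd)
      refine mem_octagon.2 ⟨h₁, ?_⟩
      -- A fire lit at `v i` reaches norm at most `f i + κ i + (n - i) ≤ f n + κ n`.
      have h₂ := (mem_octagon.1 (hvo i)).2
      have h₃ := sub_le_l1Dist p (v i)
      have h₄ := hf i n hi
      have h₅ := hκ hi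
      linarith
  refine ⟨fun n => some (v n), ?_, ?_, ?_, ?_⟩
  · intro n x hx
    exact Option.some.inj hx ▸ hvg n
  · exact fun n => Option.some_ne_none _
  · intro n x hx
    obtain rfl := Option.some.inj hx
    refine ⟨hvg (n + 1), fun hburn => ?_⟩
    obtain ⟨i, hi, h⟩ := closedNbhd_burned_linearGrids hc hvg hburn
    exact absurd ((hv (n + 1)).2.1 i hi) (not_lt.2 h)
  · have := hcard.div (tendsto_card_linearGrids hc) (by positivity)
    rw [harea, mul_div_cancel_left₀ _ (by positivity)] at this
    refine this.congr' ?_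
    filter_upwards [eventually_gt_atTop 0] with n hn
    have hn' : (0 : ℝ) < n := by exact_mod_cast hn
    exact div_div_div_cancel_right₀ (by positivity) _ _
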